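/- Let $\gamma$ be the Euler–Mascheroni constant, $\psi=\Gamma'/\Gamma$ the digamma function, $\zeta$ the Riemann zeta function, and $\mathrm{Cl}_2(\theta)=\sum_{m=1}^\infty \frac{\sin(m\theta)}{m^2}$ Clausen's function of order two. For every integer $k\ge 1$, the following two series converge absolutely and $$\sum_{n=1}^\infty\frac{\gamma+\psi(kn)}{n^2}=\left(\frac{k^2}{2}+\frac{1}{2k}\right)\zeta(3)+\pi\sum_{j=1}^{k-1}j\,\mathrm{Cl}_2\!\left(\frac{2\pi j}{k}\right),$$ $$\sum_{n=1}^\infty\frac{(-1)^n}{n^2}\bigl(\gamma+\psi(kn)\bigr)=\left(\frac{k^2}{2}-\frac{3}{8k}\right)\zeta(3)+\pi\sum_{j=1}^{k-1}j\,\mathrm{Cl}_2\!\left(\frac{2\pi j}{k}+\frac{\pi}{k}\right),$$ where the sums over $j$ are zero when $k=1$. -/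

import Mathlib

/-- Clausen's function of order two, `Cl₂(θ) = ∑_{n ≥ 1} sin(nθ) / n²`. -/
noncomputable def clausenTwo (θ : ℝ) : ℝ :=
  ∑' n : ℕ, Real.sin (((n : ℝ) + 1) * θ) / ((n : ℝ) + 1) ^ 2

/-!
Since `γ + ψ(m) = H_{m-1}` for positive integers `m`, both series are instances of
`∑ (±1)ⁿ H_{kn-1} / n²`. They are extracted, with a filter over `k`-th roots of `±1`, from the
Fourier expansion (`hasSum_harmonic_mul_cos`), valid for `0 ≤ x < 1`,

`∑_{m ≥ 1} (4 H_{m-1} / m² - 2 / m³) cos (2πmx) = 4π (x - 1/2) Cl₂(2πx) + 2 ζ(3)`.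

To prove it, note that `(x - 1/2) Cl₂(2πx)` is continuous on the circle because `Cl₂` vanishes at
`0` and `2π`. Expanding `Cl₂` and using that the `l`-th Fourier coefficient of the sawtooth
`x - 1/2` is `-1 / (2πil)` (and `0` for `l = 0`, in agreement with `1 / 0 = 0`), its `m`-th Fourier
coefficient is `(1 / 4π) ∑_{n ≥ 1} n⁻² (1 / (m - n) - 1 / (m + n))`. By partial fractions the
partial sums of this series are combinations of harmonic numbers, and since `H_{M+m} - H_M → 0` its
sum is `2 H_{m-1} / m² - 1 / m³` for `m ≥ 1`, while it is `-2 ζ(3)` for `m = 0`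
(`eq_of_hasSum_inv_sq_mul_inv_sub_sub_inv_add`). These coefficients are summable, so the Fourier
series converges pointwise to the function.

Finally the expansion is summed over the points `x = (2j + e) / (2k)`, `0 ≤ j < k`, with `e = 0` for
the first series and `e = 1` for the alternating one (`hasSum_neg_one_pow_mul_harmonic`). The
cosines add up to `± k` when `k ∣ m` and to `0` otherwise. The sines all add up to `0`, so the values
`Cl₂(2πx)` at these points sum to `0`, and of the weight `x - 1/2 = j/k + (e/(2k) - 1/2)` only `j/k`
contributes.
-/

open Filter Topology Complex Real

/-! ### A series with harmonic partial sums -/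

/-- Partial fractions. With `1 / 0 = 0`, the expansion valid for `n ≠ m` is off by `2 / m ^ 3` at
`n = m`. -/
lemma inv_sq_mul_inv_sub_sub_inv_add {m n : ℕ} (hm : m ≠ 0) (hn : n ≠ 0) :
    1 / (n : ℝ) ^ 2 * (1 / ((m : ℝ) - n) - 1 / ((m : ℝ) + n)) =
      1 / (m : ℝ) ^ 2 * (2 / (n : ℝ) + 1 / ((m : ℝ) - n) - 1 / ((m : ℝ) + n)) -
        if n = m then 2 / (m : ℝ) ^ 3 else 0 := by
  have hm' : (m : ℝ) ≠ 0 := by exact_mod_cast hm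
  have hn' : (n : ℝ) ≠ 0 := by exact_mod_cast hn
  split_ifs with h
  · subst h
    simp only [sub_self, div_zero]
    field_simp
    ring
  · have h1 : (m : ℝ) - n ≠ 0 := sub_ne_zero.2 (by exact_mod_cast Ne.symm h)
    have h2 : (m : ℝ) + n ≠ 0 := by positivity
    field_simp
    ring

lemma sum_inv_add_eq_harmonic_sub (m N : ℕ) :
    ∑ i ∈ Finset.range N, 1 / ((m : ℝ) + ((i : ℝ) + 1)) = harmonic (N + m) - harmonic m := by
  induction N with
  | zero => simp
  | succ N ih =>
    rw [Finset.sum_range_succ, ih, show N + 1 + m = (N + m) + 1 by ring, harmonic_succ]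
    push_cast
    rw [one_div]
    ring

/-- The summand `i = m` vanishes; those on its two sides give the two harmonic numbers. -/
lemma sum_inv_sub_eq_harmonic_sub (m M : ℕ) :
    ∑ i ∈ Finset.range (M + (m + 1)), 1 / (((m + 1 : ℕ) : ℝ) - ((i : ℝ) + 1)) =
      harmonic m - harmonic M := by
  induction M with
  | zero =>
    simp only [zero_add, harmonic_zero, Rat.cast_zero, sub_zero, Finset.sum_range_succ]
    rw [← Finset.sum_range_reflect, harmonic]
    push_cast
    simp only [sub_self, div_zero, add_zero]
    refine Finset.sum_congr rfl fun i hi => ?_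
    have : i + 1 ≤ m := Finset.mem_range.1 hi
    rw [one_div, show m - 1 - i = m - (i + 1) by lia, Nat.cast_sub this]
    push_cast
    congr 1
    ring
  | succ M ih =>
    rw [show M + 1 + (m + 1) = M + (m + 1) + 1 by ring, Finset.sum_range_succ, ih, harmonic_succ]
    have : ((m + 1 : ℕ) : ℝ) - (((M + (m + 1) : ℕ) : ℝ) + 1) = -((M + 1 : ℕ) : ℝ) := by
      push_cast; ring
    rw [this, one_div, inv_neg]
    push_cast
    ring

lemma tendsto_harmonic_add_sub_harmonic (m : ℕ) :
    Tendsto (fun M : ℕ => ((harmonic (M + m) : ℚ) : ℝ) - (harmonic M : ℚ)) atTop (𝓝 0) := by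
  induction m with
  | zero => simp
  | succ m ih =>
    have h : Tendsto (fun M : ℕ => (((M + (m + 1) : ℕ) : ℝ))⁻¹) atTop (𝓝 0) :=
      (tendsto_inv_atTop_nhds_zero_nat (𝕜 := ℝ)).comp (tendsto_add_atTop_nat (m + 1))
    refine ((ih.add h).congr fun M => ?_).trans (by simp)
    rw [← add_assoc, harmonic_succ]
    push_cast
    ring

/-- The sum of `n⁻² (1 / (m + 1 - n) - 1 / (m + 1 + n))` over `n ≥ 1`, where the summand `n = m + 1`
is `-1 / (2 (m + 1) ^ 3)` because `1 / 0 = 0`. -/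
lemma eq_of_hasSum_inv_sq_mul_inv_sub_sub_inv_add {m : ℕ} {s : ℝ}
    (h : HasSum (fun n : ℕ => 1 / ((n : ℝ) + 1) ^ 2 *
      (1 / (((m + 1 : ℕ) : ℝ) - ((n : ℝ) + 1)) - 1 / (((m + 1 : ℕ) : ℝ) + ((n : ℝ) + 1)))) s) :
    s = 2 * harmonic m / ((m : ℝ) + 1) ^ 2 - 1 / ((m : ℝ) + 1) ^ 3 := by
  have ht := h.tendsto_sum_nat.comp (tendsto_add_atTop_nat (m + 1))
  refine tendsto_nhds_unique ht ?_
  have h1 := tendsto_harmonic_add_sub_harmonic (m + 1)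
  have h2 := tendsto_harmonic_add_sub_harmonic ((m + 1) + (m + 1))
  -- The partial sum up to `M + m + 1` is the claimed value plus
  -- `(2 H_{M+m+1} - H_M - H_{M+2m+2}) / (m + 1) ^ 2`.
  have h3 := (((h1.const_mul 2).sub h2).const_mul (1 / ((m : ℝ) + 1) ^ 2)).add_const
    (2 * harmonic m / ((m : ℝ) + 1) ^ 2 - 1 / ((m : ℝ) + 1) ^ 3)
  refine (h3.congr fun M => ?_).trans (by simp)
  have hm := harmonic_succ m
  have hH : ∑ i ∈ Finset.range (M + (m + 1)), 2 / ((i : ℝ) + 1) = 2 * harmonic (M + (m + 1)) := by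
    simp [harmonic, Finset.mul_sum, div_eq_mul_inv]
  have hδ : ∑ i ∈ Finset.range (M + (m + 1)),
      (if i + 1 = m + 1 then 2 / (((m + 1 : ℕ) : ℝ)) ^ 3 else 0) = 2 / (((m + 1 : ℕ) : ℝ)) ^ 3 := by
    simp only [Nat.add_right_cancel_iff]
    rw [Finset.sum_ite_eq', if_pos (Finset.mem_range.2 (by lia))]
  have e : ∑ i ∈ Finset.range (M + (m + 1)), 1 / ((i : ℝ) + 1) ^ 2 *
      (1 / (((m + 1 : ℕ) : ℝ) - ((i : ℝ) + 1)) - 1 / (((m + 1 : ℕ) : ℝ) + ((i : ℝ) + 1))) =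
      1 / ((m + 1 : ℕ) : ℝ) ^ 2 * (2 * harmonic (M + (m + 1)) + (harmonic m - harmonic M) -
        (harmonic (M + (m + 1) + (m + 1)) - harmonic (m + 1))) - 2 / (((m + 1 : ℕ) : ℝ)) ^ 3 := by
    rw [← hH, ← hδ, ← sum_inv_sub_eq_harmonic_sub, ← sum_inv_add_eq_harmonic_sub,
      ← Finset.sum_add_distrib, ← Finset.sum_sub_distrib, Finset.mul_sum, ← Finset.sum_sub_distrib]
    refine Finset.sum_congr rfl fun i _ => ?_
    have := inv_sq_mul_inv_sub_sub_inv_add (Nat.succ_ne_zero m) (Nat.succ_ne_zero i)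
    simp only [Nat.succ_eq_add_one, Nat.cast_add_one i] at this
    exact this
  simp only [Function.comp]
  rw [e, hm, ← add_assoc M (m + 1) (m + 1)]
  push_cast
  field_simp
  ring

/-- From `H_n ≤ 1 + log n` and `log n ≤ 2 √n`, the terms are at most `3 (n + 1) ^ (-3 / 2)`. -/
lemma summable_harmonic_div_sq :
    Summable fun n : ℕ => (harmonic n : ℝ) / ((n : ℝ) + 1) ^ 2 := by
  have h : Summable fun n : ℕ => 3 * (1 / ((n + 1 : ℕ) : ℝ) ^ (3 / 2 : ℝ)) :=
    ((summable_nat_add_iff 1).2 (Real.summable_one_div_nat_rpow.2 (by norm_num))).mul_left 3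
  refine h.of_nonneg_of_le (fun n => ?_) fun n => ?_
  · have : (0 : ℚ) ≤ harmonic n := Finset.sum_nonneg fun _ _ => by positivity
    have : (0 : ℝ) ≤ harmonic n := by exact_mod_cast this
    positivity
  · have hp : (0 : ℝ) < ((n + 1 : ℕ) : ℝ) := by positivity
    have h1 : (1 : ℝ) ≤ ((n + 1 : ℕ) : ℝ) ^ (1 / 2 : ℝ) :=
      Real.one_le_rpow (by push_cast; linarith [n.cast_nonneg (α := ℝ)]) (by norm_num)
    have h2 : Real.log ((n + 1 : ℕ) : ℝ) ≤ ((n + 1 : ℕ) : ℝ) ^ (1 / 2 : ℝ) / (1 / 2) :=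
      Real.log_le_rpow_div hp.le (by norm_num)
    have h3 := harmonic_le_one_add_log (n + 1)
    have h4 : (harmonic n : ℝ) ≤ harmonic (n + 1) := by
      rw [harmonic_succ]; push_cast; linarith [show (0:ℝ) ≤ ((n : ℝ) + 1)⁻¹ by positivity]
    have h5 : ((n + 1 : ℕ) : ℝ) ^ 2 =
        ((n + 1 : ℕ) : ℝ) ^ (1 / 2 : ℝ) * ((n + 1 : ℕ) : ℝ) ^ (3 / 2 : ℝ) := by
      rw [← Real.rpow_add hp, ← Real.rpow_natCast]; norm_num
    have h6 : 0 < ((n + 1 : ℕ) : ℝ) ^ (3 / 2 : ℝ) := by positivity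
    rw [← Nat.cast_add_one, h5, div_le_iff₀ (by positivity)]
    rw [mul_comm (((n + 1 : ℕ) : ℝ) ^ (1 / 2 : ℝ)), ← mul_assoc, mul_one_div,
      div_mul_cancel₀ _ h6.ne']
    linarith

/-! ### The Fourier expansion of the sawtooth times the Clausen function -/

/-- The Fourier coefficients of the sawtooth `x - 1 / 2`; for `l = 0` both sides are `0`. -/
lemma integral_exp_mul_sawtooth (l : ℤ) :
    ∫ x in (0 : ℝ)..1, Complex.exp (-(2 * π * I * l * x)) * ((x : ℂ) - 1 / 2) =
      -1 / (2 * π * I * l) := by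
  have h := bernoulliFourierCoeff_eq one_ne_zero l
  rw [bernoulliFourierCoeff, fourierCoeffOn_eq_integral] at h
  simp only [fourier_coe_apply, bernoulliFun_one] at h
  simpa using h

lemma hasSum_clausenTwo (θ : ℝ) :
    HasSum (fun n : ℕ => Real.sin (((n : ℝ) + 1) * θ) / ((n : ℝ) + 1) ^ 2) (clausenTwo θ) := by
  refine Summable.hasSum (Summable.of_norm_bounded (g := fun n : ℕ => 1 / ((n : ℝ) + 1) ^ 2) ?_ ?_)
  · exact_mod_cast (summable_nat_add_iff 1).2 (Real.summable_one_div_nat_pow.2 one_lt_two)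
  · intro n
    rw [norm_div, Real.norm_of_nonneg (by positivity : (0:ℝ) ≤ ((n : ℝ) + 1) ^ 2)]
    gcongr
    exact Real.abs_sin_le_one _

lemma continuous_clausenTwo : Continuous clausenTwo := by
  refine continuous_tsum (u := fun n : ℕ => 1 / ((n : ℝ) + 1) ^ 2) (fun n => by fun_prop) ?_ ?_
  · exact_mod_cast (summable_nat_add_iff 1).2 (Real.summable_one_div_nat_pow.2 one_lt_two)
  · intro n θ
    rw [norm_div, Real.norm_of_nonneg (by positivity : (0:ℝ) ≤ ((n : ℝ) + 1) ^ 2)]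
    gcongr
    exact Real.abs_sin_le_one _

lemma exp_mul_sawtooth_mul_sin_eq (m : ℤ) (n : ℕ) (x : ℝ) :
    Complex.exp (-(2 * π * I * m * x)) *
        (((x : ℂ) - 1 / 2) * (Real.sin (((n : ℝ) + 1) * (2 * π * x)) / ((n : ℝ) + 1) ^ 2 : ℝ)) =
      1 / (2 * I * ((n : ℂ) + 1) ^ 2) *
        (Complex.exp (-(2 * π * I * ((m - (n + 1) : ℤ) : ℂ) * x)) * ((x : ℂ) - 1 / 2) -
          Complex.exp (-(2 * π * I * ((m + (n + 1) : ℤ) : ℂ) * x)) * ((x : ℂ) - 1 / 2)) := by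
  have e1 : Complex.exp (-(2 * π * I * ((m - (n + 1) : ℤ) : ℂ) * x)) =
      Complex.exp (-(2 * π * I * m * x)) * Complex.exp (((n : ℂ) + 1) * (2 * π * x) * I) := by
    rw [← Complex.exp_add]; congr 1; push_cast; ring
  have e2 : Complex.exp (-(2 * π * I * ((m + (n + 1) : ℤ) : ℂ) * x)) =
      Complex.exp (-(2 * π * I * m * x)) * Complex.exp (-(((n : ℂ) + 1) * (2 * π * x)) * I) := by
    rw [← Complex.exp_add]; congr 1; push_cast; ring
  rw [e1, e2]
  push_cast
  rw [Complex.sin]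
  have : ((n : ℂ) + 1) ≠ 0 := by exact_mod_cast n.succ_ne_zero
  field_simp
  rw [I_sq]
  ring

lemma integral_exp_mul_sawtooth_mul_sin (m : ℤ) (n : ℕ) :
    ∫ x in (0 : ℝ)..1, Complex.exp (-(2 * π * I * m * x)) *
        (((x : ℂ) - 1 / 2) * (Real.sin (((n : ℝ) + 1) * (2 * π * x)) / ((n : ℝ) + 1) ^ 2 : ℝ)) =
      ((1 / (4 * π) * (1 / ((n : ℝ) + 1) ^ 2 *
        (1 / ((m : ℝ) - ((n : ℝ) + 1)) - 1 / ((m : ℝ) + ((n : ℝ) + 1)))) : ℝ) : ℂ) := by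
  simp_rw [exp_mul_sawtooth_mul_sin_eq]
  rw [intervalIntegral.integral_const_mul, intervalIntegral.integral_sub,
    integral_exp_mul_sawtooth, integral_exp_mul_sawtooth]
  · push_cast
    have h1 (a : ℂ) : -1 / (2 * π * I * a) = I / (2 * π) * (1 / a) := by
      rw [← I_mul_I, mul_comm (2 * (π : ℂ)) I, mul_assoc I, mul_div_mul_left _ _ I_ne_zero,
        div_mul_div_comm, mul_one]
    rw [h1, h1]
    have : ((n : ℂ) + 1) ≠ 0 := by exact_mod_cast n.succ_ne_zero
    have hπ : (π : ℂ) ≠ 0 := by exact_mod_cast Real.pi_ne_zero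
    field_simp
    ring
  all_goals exact Continuous.intervalIntegrable (by fun_prop) _ _

/-- The `m`-th Fourier coefficient of `(x - 1 / 2) Cl₂(2πx)`, by integrating the series of `Cl₂`
termwise. -/
lemma hasSum_integral_exp_mul_sawtooth_mul_clausenTwo (m : ℤ) :
    HasSum (fun n : ℕ => ((1 / (4 * π) * (1 / ((n : ℝ) + 1) ^ 2 *
        (1 / ((m : ℝ) - ((n : ℝ) + 1)) - 1 / ((m : ℝ) + ((n : ℝ) + 1)))) : ℝ) : ℂ))
      (∫ x in (0 : ℝ)..1, Complex.exp (-(2 * π * I * m * x)) *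
        (((x : ℂ) - 1 / 2) * clausenTwo (2 * π * x))) := by
  have h : HasSum (fun n : ℕ => ∫ x in (0 : ℝ)..1, Complex.exp (-(2 * π * I * m * x)) *
        (((x : ℂ) - 1 / 2) * (Real.sin (((n : ℝ) + 1) * (2 * π * x)) / ((n : ℝ) + 1) ^ 2 : ℝ)))
      (∫ x in (0 : ℝ)..1, Complex.exp (-(2 * π * I * m * x)) *
        (((x : ℂ) - 1 / 2) * clausenTwo (2 * π * x))) := by
    refine intervalIntegral.hasSum_integral_of_dominated_convergence
      (fun n _ => 1 / ((n : ℝ) + 1) ^ 2) (fun n => ?_) (fun n => ?_) ?_ ?_ ?_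
    · exact Continuous.aestronglyMeasurable (by fun_prop)
    · refine Filter.Eventually.of_forall fun x hx => ?_
      rw [Set.uIoc_of_le zero_le_one] at hx
      have a1 : ‖Complex.exp (-(2 * π * I * m * x))‖ = 1 := by
        rw [show -(2 * π * I * m * x) = ((-(2 * π * m * x) : ℝ) : ℂ) * I by push_cast; ring,
          Complex.norm_exp_ofReal_mul_I]
      have a2 : ‖(x : ℂ) - 1 / 2‖ ≤ 1 := by
        rw [show (x : ℂ) - 1 / 2 = ((x - 1 / 2 : ℝ) : ℂ) by push_cast; ring, Complex.norm_real,
          Real.norm_eq_abs, abs_le]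
        constructor <;> linarith [hx.1, hx.2]
      rw [norm_mul, a1, one_mul, norm_mul, Complex.norm_real, norm_div,
        Real.norm_of_nonneg (by positivity : (0:ℝ) ≤ ((n : ℝ) + 1) ^ 2)]
      refine (mul_le_of_le_one_left (by positivity) a2).trans ?_
      gcongr
      exact Real.abs_sin_le_one _
    · refine Filter.Eventually.of_forall fun x _ => ?_
      exact_mod_cast (summable_nat_add_iff 1).2 (Real.summable_one_div_nat_pow.2 one_lt_two)
    · exact intervalIntegrable_const
    · refine Filter.Eventually.of_forall fun x _ => ?_
      exact ((Complex.hasSum_ofReal.2 (hasSum_clausenTwo (2 * π * x))).mul_left _).mul_left _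
  simp_rw [integral_exp_mul_sawtooth_mul_sin] at h
  exact h


lemma integral_exp_succ_mul_sawtooth_mul_clausenTwo (n : ℕ) :
    ∫ x in (0 : ℝ)..1, Complex.exp (-(2 * π * I * ((n + 1 : ℤ) : ℂ) * x)) *
        (((x : ℂ) - 1 / 2) * clausenTwo (2 * π * x)) =
      ((1 / (4 * π) * (2 * harmonic n / ((n : ℝ) + 1) ^ 2 - 1 / ((n : ℝ) + 1) ^ 3) : ℝ) : ℂ) := by
  have h := hasSum_integral_exp_mul_sawtooth_mul_clausenTwo (n + 1)
  obtain ⟨s, hs⟩ := Complex.summable_ofReal.1 h.summable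
  rw [h.unique (Complex.hasSum_ofReal.2 hs)]
  have h4 : (4 * π) ≠ 0 := by positivity
  have h' := hs.mul_left (4 * π)
  simp only [← mul_assoc, mul_one_div_cancel h4, one_mul] at h'
  rw [← eq_of_hasSum_inv_sq_mul_inv_sub_sub_inv_add (m := n) (s := 4 * π * s)]
  · push_cast; field_simp
  · simpa using h'

/-- The Fourier coefficients of `(x - 1 / 2) Cl₂(2πx)`, which is invariant under `x ↦ 1 - x`, are
even in the frequency. -/
lemma integral_exp_neg_succ_mul_sawtooth_mul_clausenTwo (n : ℕ) :
    ∫ x in (0 : ℝ)..1, Complex.exp (-(2 * π * I * ((-(n + 1) : ℤ) : ℂ) * x)) *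
        (((x : ℂ) - 1 / 2) * clausenTwo (2 * π * x)) =
      ((1 / (4 * π) * (2 * harmonic n / ((n : ℝ) + 1) ^ 2 - 1 / ((n : ℝ) + 1) ^ 3) : ℝ) : ℂ) := by
  rw [← integral_exp_succ_mul_sawtooth_mul_clausenTwo]
  refine (hasSum_integral_exp_mul_sawtooth_mul_clausenTwo _).unique ?_
  convert! hasSum_integral_exp_mul_sawtooth_mul_clausenTwo (n + 1) using 4 with i
  congr 1
  push_cast
  rw [show -((n : ℝ) + 1) - (i + 1) = -((n + 1) + (i + 1)) by ring,
    show -((n : ℝ) + 1) + (i + 1) = -((n + 1) - (i + 1)) by ring, one_div_neg_eq_neg_one_div,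
    one_div_neg_eq_neg_one_div]
  ring

lemma integral_exp_zero_mul_sawtooth_mul_clausenTwo {z : ℝ}
    (hz : HasSum (fun n : ℕ => 1 / ((n : ℝ) + 1) ^ 3) z) :
    ∫ x in (0 : ℝ)..1, Complex.exp (-(2 * π * I * ((0 : ℤ) : ℂ) * x)) *
        (((x : ℂ) - 1 / 2) * clausenTwo (2 * π * x)) = ((-(1 / (2 * π) * z) : ℝ) : ℂ) := by
  refine (hasSum_integral_exp_mul_sawtooth_mul_clausenTwo _).unique (Complex.hasSum_ofReal.2 ?_)
  have h := hz.mul_left (-(1 / (2 * π)))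
  rw [neg_mul] at h
  convert! h using 2 with n
  push_cast
  rw [zero_sub, zero_add, one_div_neg_eq_neg_one_div]
  field_simp
  norm_num

/-- The Fourier expansion of `4π (x - 1 / 2) Cl₂(2πx)`, with the constant term `-2 ζ(3)` moved to the
right. -/
lemma hasSum_harmonic_mul_cos {z : ℝ} (hz : HasSum (fun n : ℕ => 1 / ((n : ℝ) + 1) ^ 3) z) {x : ℝ}
    (hx : x ∈ Set.Ico (0 : ℝ) 1) :
    HasSum (fun n : ℕ => (4 * harmonic n / ((n : ℝ) + 1) ^ 2 - 2 / ((n : ℝ) + 1) ^ 3) *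
        Real.cos (2 * π * ((n : ℝ) + 1) * x))
      (4 * π * ((x - 1 / 2) * clausenTwo (2 * π * x)) + 2 * z) := by
  have : Fact ((0 : ℝ) < 1) := ⟨one_pos⟩
  let g : ℝ → ℂ := fun x => ((x : ℂ) - 1 / 2) * clausenTwo (2 * π * x)
  have hg : Continuous g := by
    have := continuous_clausenTwo
    fun_prop
  have h0 : clausenTwo 0 = 0 := by simp [clausenTwo]
  have h1 : clausenTwo (2 * π) = 0 := by
    rw [clausenTwo, ← tsum_zero (α := ℝ) (β := ℕ)]
    refine tsum_congr fun n => ?_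
    have := Real.sin_nat_mul_two_pi_sub 0 (n + 1)
    rw [sub_zero, Real.sin_zero, neg_zero] at this
    push_cast at this
    rw [this, zero_div]
  let f : C(AddCircle (1 : ℝ), ℂ) := ⟨AddCircle.liftIco 1 0 g,
    AddCircle.liftIco_zero_continuous (by simp [g, h0, h1]) hg.continuousOn⟩
  let c : ℕ → ℝ := fun n =>
    1 / (4 * π) * (2 * harmonic n / ((n : ℝ) + 1) ^ 2 - 1 / ((n : ℝ) + 1) ^ 3)
  have hc : Summable c := by
    refine Summable.mul_left _ (Summable.sub ?_ hz.summable)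
    simpa only [mul_div_assoc] using summable_harmonic_div_sq.mul_left 2
  have hf (m : ℤ) : fourierCoeff f m = ∫ x in (0 : ℝ)..1, Complex.exp (-(2 * π * I * m * x)) *
        (((x : ℂ) - 1 / 2) * clausenTwo (2 * π * x)) := by
    change fourierCoeff (AddCircle.liftIco 1 0 g) m = _
    rw [fourierCoeff_liftIco_eq, fourierCoeffOn_eq_integral]
    simp only [fourier_coe_apply]
    simp [g]
  have hf1 (n : ℕ) : fourierCoeff f (n + 1) = c n := by
    rw [hf]; exact integral_exp_succ_mul_sawtooth_mul_clausenTwo n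
  have hf2 (n : ℕ) : fourierCoeff f (-(n + 1)) = c n := by
    rw [hf]; exact integral_exp_neg_succ_mul_sawtooth_mul_clausenTwo n
  have hf0 : fourierCoeff f 0 = ((-(1 / (2 * π) * z) : ℝ) : ℂ) := by
    rw [hf]; exact integral_exp_zero_mul_sawtooth_mul_clausenTwo hz
  have hs : Summable (fourierCoeff f) := by
    refine Summable.of_add_one_of_neg_add_one ?_ ?_
    · simpa only [hf1] using Complex.summable_ofReal.2 hc
    · simpa only [hf2] using Complex.summable_ofReal.2 hc
  have hp := has_pointwise_sum_fourier_series_of_summable hs (x : AddCircle (1 : ℝ))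
  have hfx : f (x : AddCircle (1 : ℝ)) = g x := by
    change AddCircle.liftIco (1 : ℝ) 0 g x = g x
    exact AddCircle.liftIco_zero_coe_apply hx
  rw [hfx] at hp
  -- Pair the frequencies `n` and `-n`, then remove the pair `n = 0`, in which frequency `0` is
  -- counted twice.
  have hn := hp.nat_add_neg
  have hn' := (hasSum_nat_add_iff' 1).2 hn
  simp only [smul_eq_mul, Finset.range_one, Finset.sum_singleton, Nat.cast_zero, neg_zero,
    Nat.cast_add_one, hf0, hf1, hf2, fourier_zero, mul_one] at hn'
  have h4 : (4 * π) ≠ 0 := by positivity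
  have hfin := hn'.mul_left ((4 * π : ℝ) : ℂ)
  rw [← Complex.hasSum_ofReal]
  convert! hfin using 1
  · funext n
    simp only [fourier_coe_apply]
    have e1 : Complex.exp (2 * π * I * ((n + 1 : ℤ) : ℂ) * x / (1 : ℝ)) =
        Complex.exp ((2 * π * ((n : ℂ) + 1) * x) * I) := by
      congr 1; push_cast; ring
    have e2 : Complex.exp (2 * π * I * ((-(n + 1) : ℤ) : ℂ) * x / (1 : ℝ)) =
        Complex.exp (-(2 * π * ((n : ℂ) + 1) * x) * I) := by
      congr 1; push_cast; ring
    rw [e1, e2, ← mul_add, ← Complex.two_cos, ← mul_assoc, ← Complex.ofReal_mul]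
    simp only [c]
    rw [← mul_assoc (4 * π), mul_one_div_cancel h4]
    push_cast
    ring
  · have hπ : (π : ℂ) ≠ 0 := by exact_mod_cast Real.pi_ne_zero
    simp only [g]
    push_cast
    field_simp
    ring

/-! ### Sums over roots of `±1` -/

/-- The numbers `exp (πi (2j + e) / k)`, `j < k`, are the `k`-th roots of `(-1) ^ e`; their `m`-th
powers form a geometric progression with ratio `exp (2πim / k)`. -/
lemma sum_exp_eq_ite {k : ℕ} (hk : k ≠ 0) (e m : ℕ) :
    ∑ j ∈ Finset.range k, Complex.exp (2 * π * m * ((2 * j + e) / (2 * k)) * I) =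
      ((if k ∣ m then (k : ℝ) * (-1) ^ (e * (m / k)) else 0 : ℝ) : ℂ) := by
  have hk' : (k : ℂ) ≠ 0 := by exact_mod_cast hk
  have hζ := Complex.isPrimitiveRoot_exp k hk
  set ζ := Complex.exp (2 * π * I / k) with hζd
  have hterm (j : ℕ) : Complex.exp (2 * π * m * ((2 * j + e) / (2 * k)) * I) =
      Complex.exp (π * m * e / k * I) * (ζ ^ m) ^ j := by
    rw [hζd, ← Complex.exp_nat_mul, ← Complex.exp_nat_mul, ← Complex.exp_add]
    congr 1
    field_simp
    ring
  simp_rw [hterm]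
  rw [← Finset.mul_sum]
  split_ifs with h
  · rw [(hζ.pow_eq_one_iff_dvd m).2 h]
    obtain ⟨q, rfl⟩ := h
    push_cast
    rw [Nat.mul_div_cancel_left q (Nat.pos_of_ne_zero hk), ← Complex.exp_pi_mul_I,
      ← Complex.exp_nat_mul]
    simp only [one_pow, Finset.sum_const, Finset.card_range, nsmul_eq_mul, mul_one]
    rw [mul_comm]
    congr 2
    push_cast
    field_simp
  · have h1 : ζ ^ m ≠ 1 := fun h1 => h ((hζ.pow_eq_one_iff_dvd m).1 h1)
    rw [geom_sum_eq h1, ← pow_mul, mul_comm m k, pow_mul, hζ.pow_eq_one]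
    simp

lemma sum_cos_eq_ite {k : ℕ} (hk : k ≠ 0) (e m : ℕ) :
    ∑ j ∈ Finset.range k, Real.cos (2 * π * m * ((2 * j + e) / (2 * k))) =
      if k ∣ m then (k : ℝ) * (-1) ^ (e * (m / k)) else 0 := by
  have h := congrArg Complex.re (sum_exp_eq_ite hk e m)
  rw [Complex.re_sum] at h
  rw [Complex.ofReal_re] at h
  rw [← h]
  refine Finset.sum_congr rfl fun j _ => ?_
  rw [← Complex.exp_ofReal_mul_I_re]
  push_cast
  rfl

lemma sum_sin_eq_zero {k : ℕ} (hk : k ≠ 0) (e m : ℕ) :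
    ∑ j ∈ Finset.range k, Real.sin (2 * π * m * ((2 * j + e) / (2 * k))) = 0 := by
  have h := congrArg Complex.im (sum_exp_eq_ite hk e m)
  rw [Complex.im_sum] at h
  rw [Complex.ofReal_im] at h
  rw [← h]
  refine Finset.sum_congr rfl fun j _ => ?_
  rw [← Complex.exp_ofReal_mul_I_im]
  push_cast
  rfl

lemma sum_clausenTwo_eq_zero {k : ℕ} (hk : k ≠ 0) (e : ℕ) :
    ∑ j ∈ Finset.range k, clausenTwo (2 * π * ((2 * j + e) / (2 * k))) = 0 := by
  refine (hasSum_sum fun j _ => hasSum_clausenTwo _).unique ?_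
  convert! hasSum_zero using 2 with n
  rw [← Finset.sum_div, div_eq_zero_iff]
  left
  rw [← sum_sin_eq_zero hk e (n + 1)]
  refine Finset.sum_congr rfl fun j _ => ?_
  push_cast
  congr 1
  ring

/-- A series indexed by `m = n + 1 ≥ 1` and supported on multiples of `k` may be summed over these
multiples. -/
lemma hasSum_comp_mul_succ {k : ℕ} (hk : k ≠ 0) {f : ℕ → ℝ} {s : ℝ}
    (hf : ∀ n, ¬ k ∣ n + 1 → f n = 0) (h : HasSum f s) :
    HasSum (fun n : ℕ => f (k * (n + 1) - 1)) s := by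
  have hpos (n : ℕ) : 1 ≤ k * (n + 1) := Nat.mul_pos (Nat.pos_of_ne_zero hk) n.succ_pos
  have hinj : Function.Injective fun n : ℕ => k * (n + 1) - 1 := fun a b hab => by
    have h1 : k * (a + 1) = k * (b + 1) := by
      have := hpos a; have := hpos b
      simp only at hab; lia
    exact Nat.succ_injective (Nat.eq_of_mul_eq_mul_left (Nat.pos_of_ne_zero hk) h1)
  refine (hinj.hasSum_iff fun n hn => hf n fun ⟨q, hq⟩ => hn ?_).2 h
  refine ⟨q - 1, ?_⟩
  have hq0 : q ≠ 0 := by rintro rfl; simp at hq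
  simp only
  rw [Nat.sub_add_cancel (Nat.pos_of_ne_zero hq0), ← hq, Nat.add_sub_cancel]

lemma hasSum_neg_one_pow_div_cube {z : ℝ} (hz : HasSum (fun n : ℕ => 1 / ((n : ℝ) + 1) ^ 3) z) :
    HasSum (fun n : ℕ => (-1) ^ (n + 1) / ((n : ℝ) + 1) ^ 3) (-(3 / 4) * z) := by
  have hs : Summable fun n : ℕ => (-1) ^ (n + 1) / ((n : ℝ) + 1) ^ 3 := by
    refine hz.summable.of_norm_bounded fun n => le_of_eq ?_
    rw [norm_div, norm_pow, norm_neg, norm_one, one_pow, Real.norm_of_nonneg (by positivity)]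
  obtain ⟨s, hs⟩ := hs
  -- In the sum of the two series only the even `m = n + 1` survive, each with `2 / m ^ 3`.
  have h := hasSum_comp_mul_succ two_ne_zero (fun n hn => ?_) (hs.add hz)
  · have h' : HasSum (fun n : ℕ => 1 / 4 * (1 / ((n : ℝ) + 1) ^ 3)) (s + z) := by
      convert! h using 2 with n
      rw [Nat.sub_add_cancel (by lia), pow_mul, Nat.cast_sub (by lia)]
      push_cast
      field_simp
      ring
    have := h'.unique (hz.mul_left (1 / 4))
    rwa [show -(3 / 4) * z = s by linarith]
  · rw [(Nat.not_even_iff_odd.1 fun h => hn h.two_dvd).neg_one_pow]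
    ring

/-- The Fourier expansion summed over `x = (2j + e) / (2k)` for `j < k`, multiplied by `k / 4`, in
which the term `2 / m ^ 3` of the expansion is moved to the right. -/
lemma hasSum_neg_one_pow_mul_harmonic {k : ℕ} (hk : k ≠ 0) {e : ℕ} (he : e ≤ 1) {z w : ℝ}
    (hz : HasSum (fun n : ℕ => 1 / ((n : ℝ) + 1) ^ 3) z)
    (hw : HasSum (fun n : ℕ => (-1) ^ (e * (n + 1)) / ((n : ℝ) + 1) ^ 3) w) :
    HasSum (fun n : ℕ => (-1) ^ (e * (n + 1)) * harmonic (k * (n + 1) - 1) / ((n : ℝ) + 1) ^ 2)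
      ((k : ℝ) ^ 2 / 2 * z + 1 / (2 * k) * w +
        π * ∑ j ∈ Finset.range k, j * clausenTwo (2 * π * ((2 * j + e) / (2 * k)))) := by
  have hk' : (k : ℝ) ≠ 0 := by exact_mod_cast hk
  have hmem (j : ℕ) (hj : j ∈ Finset.range k) :
      (2 * (j : ℝ) + e) / (2 * k) ∈ Set.Ico (0 : ℝ) 1 := by
    refine ⟨by positivity, ?_⟩
    rw [div_lt_one (by positivity)]
    have : 2 * j + e < 2 * k := by have := Finset.mem_range.1 hj; lia
    exact_mod_cast this
  have h := hasSum_sum fun j hj => hasSum_harmonic_mul_cos hz (hmem j hj)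
  simp_rw [← Finset.mul_sum] at h
  have hD (n : ℕ) := sum_cos_eq_ite hk e (n + 1)
  simp only [Nat.cast_add_one] at hD
  simp_rw [hD] at h
  have h' := (hasSum_comp_mul_succ hk (fun n hn => by rw [if_neg hn, mul_zero]) h).mul_left
    ((k : ℝ) / 4)
  convert! h'.add (hw.mul_left (1 / (2 * (k : ℝ)))) using 1
  · funext n
    have hpos : 1 ≤ k * (n + 1) := Nat.mul_pos (Nat.pos_of_ne_zero hk) n.succ_pos
    have hcast : ((k * (n + 1) - 1 : ℕ) : ℝ) + 1 = k * ((n : ℝ) + 1) := by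
      rw [Nat.cast_sub hpos]; push_cast; ring
    rw [Nat.sub_add_cancel hpos, if_pos (dvd_mul_right _ _), hcast,
      Nat.mul_div_cancel_left _ (Nat.pos_of_ne_zero hk)]
    field_simp
    ring
  · have hsplit : ∑ j ∈ Finset.range k, (4 * π * (((2 * (j : ℝ) + e) / (2 * k) - 1 / 2) *
        clausenTwo (2 * π * ((2 * j + e) / (2 * k)))) + 2 * z) =
        4 * π / k * ∑ j ∈ Finset.range k, j * clausenTwo (2 * π * ((2 * j + e) / (2 * k))) +
          4 * π * (e / (2 * k) - 1 / 2) *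
            ∑ j ∈ Finset.range k, clausenTwo (2 * π * ((2 * j + e) / (2 * k))) + k * (2 * z) := by
      rw [Finset.sum_add_distrib, Finset.sum_const, Finset.card_range, nsmul_eq_mul,
        Finset.mul_sum, Finset.mul_sum, ← Finset.sum_add_distrib]
      congr 1
      refine Finset.sum_congr rfl fun j _ => ?_
      field_simp
      ring
    rw [hsplit, sum_clausenTwo_eq_zero hk]
    field_simp
    ring

/-! ### The digamma series -/

lemma eulerMascheroni_add_digamma (n : ℕ) :
    (Real.eulerMascheroniConstant : ℂ) + Complex.digamma ((n : ℂ) + 1) = (harmonic n : ℚ) := by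
  rw [Complex.digamma_def, logDeriv_apply, Complex.deriv_Gamma_nat, Complex.Gamma_nat_eq_factorial,
    mul_div_cancel_left₀ _ (by exact_mod_cast n.factorial_ne_zero)]
  ring

lemma exists_riemannZeta_three_eq_and_hasSum : ∃ z : ℝ, riemannZeta 3 = (z : ℂ) ∧
    HasSum (fun n : ℕ => 1 / ((n : ℝ) + 1) ^ 3) z := by
  have hs : Summable fun n : ℕ => 1 / (n : ℝ) ^ 3 :=
    Real.summable_one_div_nat_pow.2 (by norm_num)
  refine ⟨∑' n : ℕ, 1 / (n : ℝ) ^ 3, ?_, ?_⟩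
  · have := zeta_nat_eq_tsum_of_gt_one (k := 3) (by norm_num)
    rw [Complex.ofReal_tsum]
    simpa using this
  · have := (hasSum_nat_add_iff' 1).2 hs.hasSum
    simpa using this

lemma sum_Icc_natCast_mul_eq_sum_range {k : ℕ} (f : ℕ → ℂ) :
    ∑ j ∈ Finset.Icc 1 (k - 1), (j : ℂ) * f j = ∑ j ∈ Finset.range k, (j : ℂ) * f j := by
  refine Finset.sum_subset (fun j hj => ?_) fun j hj hj' => ?_
  · rw [Finset.mem_Icc] at hj
    rw [Finset.mem_range]
    lia
  · have : j = 0 := by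
      rw [Finset.mem_range] at hj
      rw [Finset.mem_Icc] at hj'
      lia
    simp [this]

/-- Both series at once: `e = 0` is the plain and `e = 1` the alternating one. -/
lemma hasSum_neg_one_pow_mul_digamma {k : ℕ} (hk : k ≠ 0) {e : ℕ} (he : e ≤ 1) {z w : ℝ}
    (hz : HasSum (fun n : ℕ => 1 / ((n : ℝ) + 1) ^ 3) z)
    (hw : HasSum (fun n : ℕ => (-1) ^ (e * (n + 1)) / ((n : ℝ) + 1) ^ 3) w) :
    HasSum (fun n : ℕ+ => (-1 : ℂ) ^ (e * (n : ℕ)) *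
        ((Real.eulerMascheroniConstant : ℂ) + Complex.digamma ((k : ℂ) * (n : ℂ))) / (n : ℂ) ^ 2)
      ((k : ℂ) ^ 2 / 2 * z + 1 / (2 * (k : ℂ)) * w + (π : ℂ) * ∑ j ∈ Finset.Icc 1 (k - 1),
          (j : ℂ) * (clausenTwo (2 * π * ((2 * j + e) / (2 * k))) : ℂ)) := by
  have h := Complex.hasSum_ofReal.2 (hasSum_neg_one_pow_mul_harmonic hk he hz hw)
  rw [sum_Icc_natCast_mul_eq_sum_range fun j => (clausenTwo (2 * π * ((2 * j + e) / (2 * k))) : ℂ)]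
  rw [← Equiv.pnatEquivNat.symm.hasSum_iff]
  convert! h using 1
  · funext n
    have hpos : 1 ≤ k * (n + 1) := Nat.mul_pos (Nat.pos_of_ne_zero hk) n.succ_pos
    have hd := eulerMascheroni_add_digamma (k * (n + 1) - 1)
    have hcast : ((k * (n + 1) - 1 : ℕ) : ℂ) + 1 = k * ((n : ℂ) + 1) := by
      rw [Nat.cast_sub hpos]; push_cast; ring
    rw [hcast] at hd
    have hn : ((Equiv.pnatEquivNat.symm n : ℕ+) : ℕ) = n + 1 := by simp
    simp only [Function.comp_apply, hn, Nat.cast_add_one, hd]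
    push_cast
    rfl
  · push_cast
    rfl

theorem mainTheorem2 (k : ℕ) (hk : 1 ≤ k) :
    HasSum
      (fun n : ℕ+ =>
        ((Real.eulerMascheroniConstant : ℂ) + Complex.digamma ((k : ℂ) * (n : ℂ))) / (n : ℂ) ^ 2)
      (((k : ℂ) ^ 2 / 2 + 1 / (2 * (k : ℂ))) * riemannZeta 3 +
        (Real.pi : ℂ) * ∑ j ∈ Finset.Icc 1 (k - 1),
          (j : ℂ) * (clausenTwo (2 * Real.pi * (j : ℝ) / (k : ℝ)) : ℂ)) ∧
    HasSum
      (fun n : ℕ+ =>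
        (-1 : ℂ) ^ (n : ℕ) *
          ((Real.eulerMascheroniConstant : ℂ) + Complex.digamma ((k : ℂ) * (n : ℂ))) / (n : ℂ) ^ 2)
      (((k : ℂ) ^ 2 / 2 - 3 / (8 * (k : ℂ))) * riemannZeta 3 +
        (Real.pi : ℂ) * ∑ j ∈ Finset.Icc 1 (k - 1),
          (j : ℂ) * (clausenTwo (2 * Real.pi * (j : ℝ) / (k : ℝ) + Real.pi / (k : ℝ)) : ℂ)) := by
  obtain ⟨z, hζ, hz⟩ := exists_riemannZeta_three_eq_and_hasSum
  have hk0 : k ≠ 0 := Nat.one_le_iff_ne_zero.1 hk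
  have hkc : (k : ℂ) ≠ 0 := by exact_mod_cast hk0
  rw [hζ]
  constructor
  · have h := hasSum_neg_one_pow_mul_digamma hk0 zero_le_one hz (w := z) (by simpa using hz)
    convert! h using 1
    · simp
    · rw [add_mul]
      congr 2
      refine Finset.sum_congr rfl fun j _ => ?_
      congr 3
      push_cast
      field_simp
      ring
  · have h := hasSum_neg_one_pow_mul_digamma hk0 le_rfl hz
      (by simpa only [one_mul] using hasSum_neg_one_pow_div_cube hz)
    convert! h using 1
    · simp
    · congr 1
      · push_cast
        field_simp
        ring
      · congr 1
        refine Finset.sum_congr rfl fun j _ => ?_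
        congr 3
        push_cast
        field_simp
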